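/- Conventions. Let $\mathcal E$ be an additive category and $\mathcal S$ a class of kernel-cokernel pairs in $\mathcal E$, closed under isomorphism, such that $(\mathcal E,\mathcal S)$ is a (Quillen) exact category; members of $\mathcal S$ are called admissible short exact sequences, and their first and second morphisms are called admissible monomorphisms and admissible epimorphisms. An object is projective (resp. injective) if morphisms from it lift through all admissible epimorphisms (resp. morphisms to it extend along all admissible monomorphisms). $(\mathcal E,\mathcal S)$ is Frobenius exact if it has enough projectives and enough injectives and the projective and the injective objects coincide. Its stable category then has the same objects, and morphism groups $\operatorname{Hom}(X,Y)/\mathcal P(X,Y)$, where $\mathcal P(X,Y)$ is the subgroup of morphisms factoring through a projective object; equivalently, through an injective object. For $k\ge 0$, let $\operatorname{MMor}_k(\mathcal E)$ be the full subcategory of the category of diagrams $X_1\to X_2\to\cdots\to X_{k+1}$ in $\mathcal E$ on the diagrams all of whose $k$ morphisms $X_i\to X_{i+1}$ are admissible monomorphisms, and let $\operatorname{MMor}_k(\mathcal S)$ be the class of sequences $X_\bullet\to Y_\bullet\to Z_\bullet$ in it such that $X_i\to Y_i\to Z_i$ lies in $\mathcal S$ for every $i$. Theorem. Let $(\mathcal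 E,\mathcal S)$ be a Frobenius exact category. (1) For every $k\ge 0$, $(\operatorname{MMor}_k(\mathcal E),\operatorname{MMor}_k(\mathcal S))$ is a Frobenius exact category. (2) For every $k\ge 0$ and every object $X_\bullet$ of $\operatorname{MMor}_k(\mathcal E)$, the following are equivalent: $X_\bullet$ is projective; $X_\bullet$ is injective; every $X_i$ is projective-injective in $\mathcal E$ and every $X_i\to X_{i+1}$ is a split monomorphism. (3) Let $N\ge 2$ and define the $N$-stable category $\operatorname{stab}_N(\mathcal E)$ to be the stable category of $\operatorname{MMor}_{N-2}(\mathcal E)$. In $\operatorname{MMor}_{N-2}(\mathcal E)$, the subgroup of morphisms factoring through a projective object and the subgroup of those factoring through an injective object coincide, so that the projectively stable and the injectively stable categories agree. The canonical functor $\operatorname{MMor}_{N-2}(\mathcal E)\to\operatorname{stab}_N(\mathcal E)$ is additive, full and bijective on objects, and it identifies two parallel morphisms $f,g$ if and only if $f-g$ factors through a diagram of projective-injective objects of $\mathcal E$ all of whose morphisms are split monomorphisms. -/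

import Mathlib

open CategoryTheory CategoryTheory.Limits

universe v u

namespace NStab

section Exact

variable {C : Type u} [Category.{v} C] [Preadditive C]

/-- `f` is an admissible monomorphism for the class `S` of short complexes: it is the first
morphism of a member of `S`. -/
def AdmissibleMono (S : ObjectProperty (ShortComplex C)) {X Y : C} (f : X ⟶ Y) : Prop :=
  ∃ (Z : C) (g : Y ⟶ Z) (w : f ≫ g = 0), S (ShortComplex.mk f g w)

/-- `g` is an admissible epimorphism for the class `S` of short complexes: it is the second
morphism of a member of `S`. -/
def AdmissibleEpi (S : ObjectProperty (ShortComplex C)) {Y Z : C} (g : Y ⟶ Z) : Prop :=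
  ∃ (X : C) (f : X ⟶ Y) (w : f ≫ g = 0), S (ShortComplex.mk f g w)

/-- `C` is additive and `(C, S)` is an exact category (in the sense of Quillen), where `S` is the
class of admissible short exact sequences. -/
structure IsExactCategory (S : ObjectProperty (ShortComplex C)) : Prop where
  hasFiniteBiproducts : HasFiniteBiproducts C
  iso_closed : ∀ {T T' : ShortComplex C}, (T ≅ T') → S T → S T'
  isKernel : ∀ {T : ShortComplex C}, S T → Nonempty (IsLimit (KernelFork.ofι T.f T.zero))
  isCokernel : ∀ {T : ShortComplex C}, S T → Nonempty (IsColimit (CokernelCofork.ofπ T.g T.zero))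
  id_mono : ∀ X : C, AdmissibleMono S (𝟙 X)
  id_epi : ∀ X : C, AdmissibleEpi S (𝟙 X)
  comp_mono : ∀ {X Y Z : C} (f : X ⟶ Y) (g : Y ⟶ Z),
    AdmissibleMono S f → AdmissibleMono S g → AdmissibleMono S (f ≫ g)
  comp_epi : ∀ {X Y Z : C} (f : X ⟶ Y) (g : Y ⟶ Z),
    AdmissibleEpi S f → AdmissibleEpi S g → AdmissibleEpi S (f ≫ g)
  pushout_mono : ∀ {X Y X' : C} (f : X ⟶ Y) (h : X ⟶ X'), AdmissibleMono S f →
    ∃ (Y' : C) (h' : Y ⟶ Y') (f' : X' ⟶ Y'), IsPushout f h h' f' ∧ AdmissibleMono S f'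
  pullback_epi : ∀ {Y Z Z' : C} (g : Y ⟶ Z) (h : Z' ⟶ Z), AdmissibleEpi S g →
    ∃ (Y' : C) (h' : Y' ⟶ Y) (g' : Y' ⟶ Z'), IsPullback h' g' g h ∧ AdmissibleEpi S g'

/-- Projective objects relative to `S`: morphisms lift through admissible epimorphisms. -/
def IsProjective (S : ObjectProperty (ShortComplex C)) : ObjectProperty C := fun P =>
  ∀ ⦃Y Z : C⦄ (p : Y ⟶ Z), AdmissibleEpi S p → ∀ f : P ⟶ Z, ∃ g : P ⟶ Y, g ≫ p = f

/-- Injective objects relative to `S`: morphisms extend along admissible monomorphisms. -/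
def IsInjective (S : ObjectProperty (ShortComplex C)) : ObjectProperty C := fun I =>
  ∀ ⦃X Y : C⦄ (i : X ⟶ Y), AdmissibleMono S i → ∀ f : X ⟶ I, ∃ g : Y ⟶ I, i ≫ g = f

/-- `(C, S)` is a Frobenius exact category. -/
structure IsFrobeniusExact (S : ObjectProperty (ShortComplex C)) : Prop
    extends IsExactCategory S where
  enough_projectives : ∀ X : C, ∃ (P : C) (p : P ⟶ X), IsProjective S P ∧ AdmissibleEpi S p
  enough_injectives : ∀ X : C, ∃ (I : C) (i : X ⟶ I), IsInjective S I ∧ AdmissibleMono S i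
  projective_iff_injective : ∀ X : C, IsProjective S X ↔ IsInjective S X

end Exact

section Stable

variable {C : Type u} [Category.{v} C] [Preadditive C]

/-- `f` factors through an object satisfying `Q`. -/
def FactorsThrough (Q : ObjectProperty C) {X Y : C} (f : X ⟶ Y) : Prop :=
  ∃ (P : C) (a : X ⟶ P) (b : P ⟶ Y), Q P ∧ a ≫ b = f

/-- The additive subgroup of `X ⟶ Y` generated by the morphisms which factor through an object
satisfying `Q`. (When `Q` is closed under finite direct sums, these morphisms already form a
subgroup.) -/
def factorIdeal (Q : ObjectProperty C) (X Y : C) : AddSubgroup (X ⟶ Y) :=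
  AddSubgroup.closure {f | FactorsThrough Q f}

/-- Two morphisms are identified when their difference lies in `factorIdeal Q`. -/
def factorRel (Q : ObjectProperty C) : HomRel C :=
  fun X Y f g => f - g ∈ factorIdeal Q X Y

theorem comp_mem_factorIdeal (Q : ObjectProperty C) {X Y Z : C} (f : X ⟶ Y) {g : Y ⟶ Z}
    (hg : g ∈ factorIdeal Q Y Z) : f ≫ g ∈ factorIdeal Q X Z := by
  induction hg using AddSubgroup.closure_induction with
  | mem x hx =>
    obtain ⟨P, a, b, hP, rfl⟩ := hx
    exact AddSubgroup.subset_closure ⟨P, f ≫ a, b, hP, by simp⟩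
  | zero => simp
  | add x y _ _ hx hy => simpa using AddSubgroup.add_mem _ hx hy
  | neg x _ hx => simpa using hx

theorem mem_factorIdeal_comp (Q : ObjectProperty C) {X Y Z : C} {f : X ⟶ Y} (g : Y ⟶ Z)
    (hf : f ∈ factorIdeal Q X Y) : f ≫ g ∈ factorIdeal Q X Z := by
  induction hf using AddSubgroup.closure_induction with
  | mem x hx =>
    obtain ⟨P, a, b, hP, rfl⟩ := hx
    exact AddSubgroup.subset_closure ⟨P, a, b ≫ g, hP, by simp⟩
  | zero => simp
  | add x y _ _ hx hy => simpa using AddSubgroup.add_mem _ hx hy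
  | neg x _ hx => simpa using hx

instance factorRel_congruence (Q : ObjectProperty C) : Congruence (factorRel Q) where
  comp_left f g g' h := by
    simpa [factorRel] using comp_mem_factorIdeal Q f h
  comp_right g h := by
    simpa [factorRel] using mem_factorIdeal_comp Q g h
  equivalence :=
    { refl := fun f => by simp [factorRel]
      symm := fun {f g} h => by
        simpa [factorRel] using AddSubgroup.neg_mem _ h
      trans := fun {f g h} h₁ h₂ => by
        simpa [factorRel] using AddSubgroup.add_mem _ h₁ h₂ }

/-- The additive quotient `C / [Q]`: same objects as `C`, with morphisms
`Hom(X, Y) / factorIdeal Q X Y`. -/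
abbrev AdditiveQuotient (Q : ObjectProperty C) : Type u := Quotient (factorRel Q)

instance additiveQuotientPreadditive (Q : ObjectProperty C) : Preadditive (AdditiveQuotient Q) :=
  Quotient.preadditive _ (fun _ _ f₁ f₂ g₁ g₂ h₁ h₂ => by
    have := AddSubgroup.add_mem _ h₁ h₂
    rwa [sub_add_sub_comm] at this)

/-- The projectively stable category of `(C, S)`. For a Frobenius exact category this is
the stable category. -/
abbrev StableCategory (S : ObjectProperty (ShortComplex C)) : Type u :=
  AdditiveQuotient (IsProjective S)

/-- The injectively stable category of `(C, S)`. -/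
abbrev InjectivelyStableCategory (S : ObjectProperty (ShortComplex C)) : Type u :=
  AdditiveQuotient (IsInjective S)

end Stable

section Monomorphism

variable {C : Type u} [Category.{v} C] [Preadditive C]

/-- A diagram `X₀ ⟶ ⋯ ⟶ Xₖ` of `k` composable morphisms is a diagram of admissible
monomorphisms. -/
def isMMor (S : ObjectProperty (ShortComplex C)) (k : ℕ) :
    ObjectProperty (ComposableArrows C k) := fun X =>
  ∀ i : Fin k, AdmissibleMono S (X.map (homOfLE i.castSucc_le_succ))

/-- The monomorphism category `MMor_k`: the full subcategory of the category of diagrams of `k`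
composable morphisms on those consisting of admissible monomorphisms. -/
abbrev MMor (S : ObjectProperty (ShortComplex C)) (k : ℕ) : Type (max u v) :=
  (isMMor S k).FullSubcategory

/-- The admissible short exact sequences of `MMor_k`: those which are componentwise admissible
in `C`. -/
def mmorAdmissible (S : ObjectProperty (ShortComplex C)) (k : ℕ) :
    ObjectProperty (ShortComplex (MMor S k)) := fun T =>
  ∀ i : Fin (k + 1),
    S (T.map ((isMMor S k).ι ⋙ (evaluation (Fin (k + 1)) C).obj i))

/-- A diagram of projective-injective objects in which every morphism is a split
monomorphism. -/
def IsSplitProjInjDiagram (S : ObjectProperty (ShortComplex C)) (k : ℕ) :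
    ObjectProperty (MMor S k) := fun X =>
  (∀ i : Fin (k + 1), IsProjective S (X.obj.obj i) ∧ IsInjective S (X.obj.obj i)) ∧
    ∀ i : Fin k, IsSplitMono (X.obj.map (homOfLE i.castSucc_le_succ))

/-- The `N`-stable category (for `2 ≤ N`): the stable category of `MMor_{N-2}`. -/
abbrev NStableCategory (S : ObjectProperty (ShortComplex C)) (N : ℕ) : Type (max u v) :=
  StableCategory (mmorAdmissible S (N - 2))

/-- The canonical functor from `MMor_{N-2}` to the `N`-stable category. -/
abbrev toNStable (S : ObjectProperty (ShortComplex C)) (N : ℕ) :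
    MMor S (N - 2) ⥤ NStableCategory S N :=
  Quotient.functor _

end Monomorphism

end NStab

/-!
The diagrams of `k` admissible monomorphisms form an extension-closed subcategory of the category
of all functors `Fin (k + 1) ⥤ C`, and everything is deduced from this.

*Exactness.* Functors with values in an exact category form an exact category for the objectwise
structure (`IsExactCategory.functorCategory`), because pushouts along admissible monomorphisms and
pullbacks along admissible epimorphisms are computed objectwise. An extension-closed full
subcategory of an exact category is exact (`IsExactCategory.fullSubcategory`); closure under
compositions rests on Noether's isomorphism theorem (`IsExactCategory.conflation_quotients`). By
the five lemma for admissible monomorphisms (`IsExactCategory.admissibleMono_of_conflation`) the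
diagrams of admissible monomorphisms are closed under extensions. An objectwise admissible
epimorphism of such diagrams need not be admissible, since `C` is not assumed to be weakly
idempotent complete; the extension-closed subcategory argument does not need this.

*Filtration.* The evaluation at `i` has a left adjoint `freeAt i`, which sends `A` to the diagram
`0 ⟶ ⋯ ⟶ 0 ⟶ A ⟶ ⋯ ⟶ A` with identities between the copies of `A`. Every diagram `X` of
admissible monomorphisms is an iterated extension of such diagrams, obtained by dividing
successively by the diagram generated by the first nonzero term
(`IsExactCategory.mmor_induction`).

*Projectives and injectives.* If `L` has injective terms, then `Ext¹(freeAt i A, L)`, which is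
`Ext¹(A, L i)` by adjunction, vanishes, and so does `Ext¹(-, L)` by the filtration: `L` is
injective. By the horseshoe lemma along the filtration, every diagram is an admissible quotient of
a projective diagram with projective terms, and an admissible subobject of an injective diagram
with injective terms. Hence the injective diagrams are exactly those with injective terms, and a
projective diagram has projective terms. Conversely, if `X` has projective terms and `P ⟶ X` is an
admissible epimorphism as above with kernel `K`, then the terms of `K` are retracts of those of
`P`, hence injective, so `K` is injective, the epimorphism splits and `X` is projective. The
morphisms of a diagram with injective terms split since they are admissible monomorphisms.

*The stable category.* The morphisms factoring through a projective object are closed under sums,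
since projective objects are closed under biproducts (`IsExactCategory.mem_factorIdeal_iff`).
-/

namespace NStab

/-! ### Admissible short exact sequences and duality -/

section Basic

variable {C : Type u} [Category.{v} C] [Preadditive C] {S : ObjectProperty (ShortComplex C)}

/-- The pair `X ⟶ Y ⟶ Z` is a member of `S`; the vanishing of the composition is part of the
assertion. -/
def Conflation (S : ObjectProperty (ShortComplex C)) {X Y Z : C} (f : X ⟶ Y) (g : Y ⟶ Z) : Prop :=
  ∃ w : f ≫ g = 0, S (ShortComplex.mk f g w)

theorem Conflation.zero {X Y Z : C} {f : X ⟶ Y} {g : Y ⟶ Z} (h : Conflation S f g) :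
    f ≫ g = 0 := h.1

theorem Conflation.admissibleMono {X Y Z : C} {f : X ⟶ Y} {g : Y ⟶ Z} (h : Conflation S f g) :
    AdmissibleMono S f := ⟨Z, g, h⟩

theorem Conflation.admissibleEpi {X Y Z : C} {f : X ⟶ Y} {g : Y ⟶ Z} (h : Conflation S f g) :
    AdmissibleEpi S g := ⟨X, f, h⟩

theorem nonempty_isLimit_kernelFork {X Y Z : C} {f : X ⟶ Y} {g : Y ⟶ Z} (w : f ≫ g = 0) [Mono f]
    (lift : ∀ ⦃T : C⦄ (t : T ⟶ Y), t ≫ g = 0 → ∃ s : T ⟶ X, s ≫ f = t) :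
    Nonempty (IsLimit (KernelFork.ofι f w)) :=
  ⟨KernelFork.IsLimit.ofι _ _ (fun t ht => (lift t ht).choose)
    (fun t ht => (lift t ht).choose_spec)
    (fun t ht m hm => by rw [← cancel_mono f, hm, (lift t ht).choose_spec])⟩

theorem nonempty_isColimit_cokernelCofork {X Y Z : C} {f : X ⟶ Y} {g : Y ⟶ Z} (w : f ≫ g = 0)
    [Epi g] (desc : ∀ ⦃T : C⦄ (t : Y ⟶ T), f ≫ t = 0 → ∃ s : Z ⟶ T, g ≫ s = t) :
    Nonempty (IsColimit (CokernelCofork.ofπ g w)) :=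
  ⟨CokernelCofork.IsColimit.ofπ _ _ (fun t ht => (desc t ht).choose)
    (fun t ht => (desc t ht).choose_spec)
    (fun t ht m hm => by rw [← cancel_epi g, hm, (desc t ht).choose_spec])⟩

namespace IsExactCategory

variable (hS : IsExactCategory S)

include hS

theorem mono {X Y Z : C} {f : X ⟶ Y} {g : Y ⟶ Z} (h : Conflation S f g) : Mono f := by
  obtain ⟨w, h⟩ := h
  exact mono_of_isLimit_fork (hS.isKernel h).some

theorem epi {X Y Z : C} {f : X ⟶ Y} {g : Y ⟶ Z} (h : Conflation S f g) : Epi g := by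
  obtain ⟨w, h⟩ := h
  exact epi_of_isColimit_cofork (hS.isCokernel h).some

theorem lift {X Y Z T : C} {f : X ⟶ Y} {g : Y ⟶ Z} (h : Conflation S f g) (t : T ⟶ Y)
    (ht : t ≫ g = 0) : ∃ s : T ⟶ X, s ≫ f = t := by
  obtain ⟨w, h⟩ := h
  exact ⟨_, (KernelFork.IsLimit.lift' (hS.isKernel h).some t ht).2⟩

theorem desc {X Y Z T : C} {f : X ⟶ Y} {g : Y ⟶ Z} (h : Conflation S f g) (t : Y ⟶ T)
    (ht : f ≫ t = 0) : ∃ s : Z ⟶ T, g ≫ s = t := by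
  obtain ⟨w, h⟩ := h
  exact ⟨_, (CokernelCofork.IsColimit.desc' (hS.isCokernel h).some t ht).2⟩

theorem conflation_of_iso {X Y Z X' Y' Z' : C} {f : X ⟶ Y} {g : Y ⟶ Z} {f' : X' ⟶ Y'}
    {g' : Y' ⟶ Z'} (h : Conflation S f g) (e₁ : X ≅ X') (e₂ : Y ≅ Y') (e₃ : Z ≅ Z')
    (h₁ : e₁.hom ≫ f' = f ≫ e₂.hom) (h₂ : e₂.hom ≫ g' = g ≫ e₃.hom) : Conflation S f' g' := by
  obtain ⟨w, h⟩ := h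
  have w' : f' ≫ g' = 0 := by
    rw [← cancel_epi e₁.hom, reassoc_of% h₁, h₂, reassoc_of% w]; simp
  exact ⟨w', hS.iso_closed (T := ShortComplex.mk f g w) (T' := ShortComplex.mk f' g' w')
    (ShortComplex.isoMk e₁ e₂ e₃ h₁ h₂) h⟩

end IsExactCategory

/-- The class of short complexes in `Cᵒᵖ` opposite to those in `S`. -/
def opClass (S : ObjectProperty (ShortComplex C)) : ObjectProperty (ShortComplex Cᵒᵖ) :=
  fun T => S T.unop

theorem Conflation.op {X Y Z : C} {f : X ⟶ Y} {g : Y ⟶ Z} (h : Conflation S f g) :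
    Conflation (opClass S) g.op f.op :=
  ⟨by rw [← op_comp, h.1, op_zero], h.2⟩

theorem Conflation.unop {X Y Z : Cᵒᵖ} {f : X ⟶ Y} {g : Y ⟶ Z} (h : Conflation (opClass S) f g) :
    Conflation S g.unop f.unop :=
  ⟨by rw [← unop_comp, h.1, unop_zero], h.2⟩

theorem AdmissibleMono.op {X Y : C} {f : X ⟶ Y} (h : AdmissibleMono S f) :
    AdmissibleEpi (opClass S) f.op := by
  obtain ⟨Z, g, h⟩ := h
  exact Conflation.admissibleEpi (Conflation.op h)

theorem AdmissibleEpi.op {X Y : C} {f : X ⟶ Y} (h : AdmissibleEpi S f) :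
    AdmissibleMono (opClass S) f.op := by
  obtain ⟨Z, g, h⟩ := h
  exact Conflation.admissibleMono (Conflation.op h)

theorem AdmissibleMono.unop {X Y : Cᵒᵖ} {f : X ⟶ Y} (h : AdmissibleMono (opClass S) f) :
    AdmissibleEpi S f.unop := by
  obtain ⟨Z, g, h⟩ := h
  exact Conflation.admissibleEpi (Conflation.unop h)

theorem AdmissibleEpi.unop {X Y : Cᵒᵖ} {f : X ⟶ Y} (h : AdmissibleEpi (opClass S) f) :
    AdmissibleMono S f.unop := by
  obtain ⟨Z, g, h⟩ := h
  exact Conflation.admissibleMono (Conflation.unop h)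

namespace IsExactCategory

variable (hS : IsExactCategory S)

include hS

/-- The axioms of an exact category are self-dual. -/
theorem op : IsExactCategory (opClass S) where
  hasFiniteBiproducts := by
    have := hS.hasFiniteBiproducts
    exact HasFiniteBiproducts.of_hasFiniteProducts
  iso_closed e h := hS.iso_closed ⟨ShortComplex.unopMap e.inv, ShortComplex.unopMap e.hom,
    by rw [← ShortComplex.unopMap_id, ← e.hom_inv_id]; rfl,
    by rw [← ShortComplex.unopMap_id, ← e.inv_hom_id]; rfl⟩ h
  isKernel {T} h := by
    have hT : Conflation S T.g.unop T.f.unop := ⟨_, h⟩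
    have := hS.epi hT
    have : Mono T.f := inferInstanceAs (Mono T.f.unop.op)
    refine nonempty_isLimit_kernelFork _ fun A t ht => ?_
    obtain ⟨s, hs⟩ := hS.desc hT t.unop (by rw [← unop_comp, ht, unop_zero])
    exact ⟨s.op, Quiver.Hom.unop_inj hs⟩
  isCokernel {T} h := by
    have hT : Conflation S T.g.unop T.f.unop := ⟨_, h⟩
    have := hS.mono hT
    have : Epi T.g := inferInstanceAs (Epi T.g.unop.op)
    refine nonempty_isColimit_cokernelCofork _ fun A t ht => ?_
    obtain ⟨s, hs⟩ := hS.lift hT t.unop (by rw [← unop_comp, ht, unop_zero])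
    exact ⟨s.op, Quiver.Hom.unop_inj hs⟩
  id_mono X := (hS.id_epi X.unop).op
  id_epi X := (hS.id_mono X.unop).op
  comp_mono f g hf hg := (hS.comp_epi _ _ hg.unop hf.unop).op
  comp_epi f g hf hg := (hS.comp_mono _ _ hg.unop hf.unop).op
  pushout_mono f h hf := by
    obtain ⟨Y', h', g', sq, hg⟩ := hS.pullback_epi f.unop h.unop hf.unop
    exact ⟨_, h'.op, g'.op, sq.op.flip, hg.op⟩
  pullback_epi f h hf := by
    obtain ⟨Y', h', g', sq, hg⟩ := hS.pushout_mono f.unop h.unop hf.unop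
    exact ⟨_, h'.op, g'.op, sq.op.flip, hg.op⟩

/-! ### Elementary properties of admissible morphisms -/

theorem admissibleMono_of_isIso {X Y : C} (f : X ⟶ Y) [IsIso f] : AdmissibleMono S f := by
  obtain ⟨Z, g, h⟩ := hS.id_mono X
  exact (hS.conflation_of_iso (f' := f) (g' := inv f ≫ g) h (Iso.refl _) (asIso f) (Iso.refl _)
    (by simp) (by simp)).admissibleMono

theorem conflation_of_isIso_of_isZero {X Y Z : C} (f : X ⟶ Y) (g : Y ⟶ Z) [IsIso f]
    (hZ : IsZero Z) : Conflation S f g := by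
  obtain ⟨W, q, h⟩ := hS.admissibleMono_of_isIso f
  have := hS.epi h
  have hW : IsZero W := by
    rw [IsZero.iff_id_eq_zero, ← cancel_epi q, ← cancel_epi f]
    have := Conflation.zero h
    simp [this]
  exact hS.conflation_of_iso h (Iso.refl _) (Iso.refl _) (hW.iso hZ) (by simp)
    (hZ.eq_of_tgt _ _)

theorem conflation_of_isZero_of_isIso {X Y Z : C} (f : X ⟶ Y) (g : Y ⟶ Z) [IsIso g]
    (hX : IsZero X) : Conflation S f g :=
  (hS.op.conflation_of_isIso_of_isZero g.op f.op hX.op).unop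

theorem admissibleMono_of_isZero {X Y : C} (f : X ⟶ Y) (hX : IsZero X) : AdmissibleMono S f :=
  (hS.conflation_of_isZero_of_isIso f (𝟙 Y) hX).admissibleMono

theorem conflation_of_isCokernel {X Y Z : C} {f : X ⟶ Y} {g : Y ⟶ Z} (hf : AdmissibleMono S f)
    (w : f ≫ g = 0) [Epi g] (desc : ∀ ⦃T : C⦄ (t : Y ⟶ T), f ≫ t = 0 → ∃ s : Z ⟶ T, g ≫ s = t) :
    Conflation S f g := by
  obtain ⟨Q, q, h⟩ := hf
  have h : Conflation S f q := h
  have := hS.epi h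
  obtain ⟨a, ha⟩ := hS.desc h g w
  obtain ⟨b, hb⟩ := desc q h.zero
  refine hS.conflation_of_iso h (Iso.refl _) (Iso.refl _)
    ⟨a, b, ?_, ?_⟩ (by simp) (by simp [ha])
  · rw [← cancel_epi q, reassoc_of% ha, hb, Category.comp_id]
  · rw [← cancel_epi g, reassoc_of% hb, ha, Category.comp_id]

theorem conflation_of_isKernel {X Y Z : C} {f : X ⟶ Y} {g : Y ⟶ Z} (hg : AdmissibleEpi S g)
    (w : f ≫ g = 0) [Mono f] (lift : ∀ ⦃T : C⦄ (t : T ⟶ Y), t ≫ g = 0 → ∃ s : T ⟶ X, s ≫ f = t) :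
    Conflation S f g := by
  refine (hS.op.conflation_of_isCokernel (f := g.op) (g := f.op) hg.op
    (by rw [← op_comp, w, op_zero]) fun T t ht => ?_).unop
  obtain ⟨s, hs⟩ := lift t.unop (by rw [← Quiver.Hom.unop_op g, ← unop_comp, ht, unop_zero])
  exact ⟨s.op, Quiver.Hom.unop_inj hs⟩

/-- In a pushout square, the pushout of an admissible monomorphism is an admissible monomorphism
with the same cokernel. -/
theorem conflation_of_isPushout {X Y X' Y' Z : C} {f : X ⟶ Y} {h : X ⟶ X'} {h' : Y ⟶ Y'}
    {f' : X' ⟶ Y'} (sq : IsPushout f h h' f') {g : Y ⟶ Z} (hf : Conflation S f g)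
    {q : Y' ⟶ Z} (hq : h' ≫ q = g) (hq' : f' ≫ q = 0) : Conflation S f' q := by
  obtain ⟨Y'', h'', f'', sq', hf''⟩ := hS.pushout_mono f h hf.admissibleMono
  have := hS.epi hf
  have hf' : AdmissibleMono S f' := by
    have e : f'' ≫ (sq'.isoIsPushout _ _ sq).hom = f' := by simp
    rw [← e]
    exact hS.comp_mono _ _ hf'' (hS.admissibleMono_of_isIso _)
  have : Epi q := by
    rw [← hq] at this
    exact epi_of_epi h' q
  refine hS.conflation_of_isCokernel hf' hq' fun T t ht => ?_
  obtain ⟨s, hs⟩ := hS.desc hf (h' ≫ t) (by rw [sq.w_assoc, ht, comp_zero])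
  exact ⟨s, sq.hom_ext (by rw [← hs, reassoc_of% hq]) (by rw [reassoc_of% hq', ht, zero_comp])⟩

theorem exists_conflation_of_isPushout {X Y X' Y' Z : C} {f : X ⟶ Y} {h : X ⟶ X'} {h' : Y ⟶ Y'}
    {f' : X' ⟶ Y'} (sq : IsPushout f h h' f') {g : Y ⟶ Z} (hf : Conflation S f g) :
    ∃ q : Y' ⟶ Z, h' ≫ q = g ∧ Conflation S f' q :=
  ⟨sq.desc g 0 (by simp [hf.zero]), by simp,
    hS.conflation_of_isPushout sq hf (by simp) (by simp)⟩

theorem admissibleMono_of_isPushout {X Y X' Y' : C} {f : X ⟶ Y} {h : X ⟶ X'} {h' : Y ⟶ Y'}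
    {f' : X' ⟶ Y'} (sq : IsPushout f h h' f') (hf : AdmissibleMono S f) : AdmissibleMono S f' := by
  obtain ⟨Z, g, hf⟩ := hf
  obtain ⟨q, -, hq⟩ := hS.exists_conflation_of_isPushout sq (g := g) hf
  exact hq.admissibleMono

/-- In a pullback square, the pullback of an admissible epimorphism is an admissible epimorphism
with the same kernel. -/
theorem exists_conflation_of_isPullback {X Y Z Y' Z' : C} {g : Y ⟶ Z} {h : Z' ⟶ Z} {h' : Y' ⟶ Y}
    {g' : Y' ⟶ Z'} (sq : IsPullback h' g' g h) {f : X ⟶ Y} (hg : Conflation S f g) :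
    ∃ i : X ⟶ Y', i ≫ h' = f ∧ Conflation S i g' := by
  obtain ⟨q, hq, h⟩ := hS.op.exists_conflation_of_isPushout sq.op.flip hg.op
  exact ⟨q.unop, Quiver.Hom.op_inj hq, h.unop⟩

theorem admissibleEpi_of_isPullback {Y Z Y' Z' : C} {g : Y ⟶ Z} {h : Z' ⟶ Z} {h' : Y' ⟶ Y}
    {g' : Y' ⟶ Z'} (sq : IsPullback h' g' g h) (hg : AdmissibleEpi S g) : AdmissibleEpi S g' :=
  (hS.op.admissibleMono_of_isPushout sq.op.flip hg.op).unop

/-- The short five lemma with identities at both ends. -/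
theorem isIso_of_conflation {A B B' Q : C} {f : A ⟶ B} {g : B ⟶ Q} {f' : A ⟶ B'} {g' : B' ⟶ Q}
    (h : Conflation S f g) (h' : Conflation S f' g') (b : B ⟶ B') (hf : f ≫ b = f')
    (hg : b ≫ g' = g) : IsIso b := by
  have := hS.mono h
  have := hS.mono h'
  have hb : Mono b := by
    refine Preadditive.mono_of_cancel_zero _ fun t ht => ?_
    obtain ⟨s, rfl⟩ := hS.lift h t (by rw [← hg, reassoc_of% ht, zero_comp])
    rw [Category.assoc, hf] at ht
    rw [Limits.zero_of_comp_mono f' ht, zero_comp]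
  obtain ⟨P, π₂, π₁, sq, -⟩ := hS.pullback_epi g' g h'.admissibleEpi
  obtain ⟨i, hi, hP⟩ := hS.exists_conflation_of_isPullback sq h'
  obtain ⟨j, hj, hP'⟩ := hS.exists_conflation_of_isPullback sq.flip h
  have := hS.mono hP
  have := hS.epi hP'
  -- The pullback `P` of `g` and `g'` is split by the section `(1, b)` of its projection to `B`.
  obtain ⟨r, hr⟩ := hS.lift hP (𝟙 P - π₁ ≫ sq.lift b (𝟙 B) (by simp [hg])) (by simp)
  have hr₂ : r ≫ f' = π₂ - π₁ ≫ b := by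
    rw [← hi, reassoc_of% hr]; simp
  have hjr : j ≫ r = -𝟙 A := by
    rw [← cancel_mono f', Category.assoc, hr₂]
    simp [hP'.zero, reassoc_of% hj, hf]
  -- The morphism `(x, y) ↦ x + f (r (x, y))` descends along `π₂` to an inverse of `b`.
  obtain ⟨ψ, hψ⟩ := hS.desc hP' (π₁ + r ≫ f) (by
    rw [Preadditive.comp_add, reassoc_of% hjr, hj]; simp)
  have h₁ : ψ ≫ b = 𝟙 B' := by
    rw [← cancel_epi π₂, reassoc_of% hψ]
    simp [hf, hr₂]
  exact ⟨ψ, by rw [← cancel_mono b, Category.assoc, h₁]; simp, h₁⟩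

/-- The five lemma for admissible monomorphisms. -/
theorem admissibleMono_of_conflation {A B Q A' B' Q' : C} {f : A ⟶ B} {g : B ⟶ Q} {f' : A' ⟶ B'}
    {g' : B' ⟶ Q'} (h : Conflation S f g) (h' : Conflation S f' g') {a : A ⟶ A'} {b : B ⟶ B'}
    {c : Q ⟶ Q'} (hab : f ≫ b = a ≫ f') (hbc : g ≫ c = b ≫ g') (ha : AdmissibleMono S a)
    (hc : AdmissibleMono S c) : AdmissibleMono S b := by
  obtain ⟨W, p, hc⟩ := hc
  have hc : Conflation S c p := hc
  have := hS.mono hc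
  have := hS.mono h'
  -- The pullback `k : D' ⟶ B'` of `c` along `g'` exists as the kernel of `g' ≫ p`.
  obtain ⟨D', k, hk⟩ := hS.comp_epi g' p h'.admissibleEpi hc.admissibleEpi
  have hk : Conflation S k (g' ≫ p) := hk
  have := hS.mono hk
  obtain ⟨d, hd⟩ := hS.lift hc (k ≫ g') (by rw [Category.assoc, hk.zero])
  have sq : IsPullback k d g' c := by
    have key (s : PullbackCone g' c) : ∃ l : s.pt ⟶ D', l ≫ k = s.fst :=
      hS.lift hk s.fst (by rw [reassoc_of% s.condition, hc.zero, comp_zero])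
    refine ⟨⟨hd.symm⟩, ⟨PullbackCone.IsLimit.mk _ (fun s => (key s).choose)
      (fun s => (key s).choose_spec) ?_ ?_⟩⟩
    · intro s
      rw [← cancel_mono c, Category.assoc, hd, reassoc_of% (key s).choose_spec, s.condition]
    · intro s m hm _
      rw [← cancel_mono k, hm, (key s).choose_spec]
  obtain ⟨i, hi, hD'⟩ := hS.exists_conflation_of_isPullback sq h'
  -- `D` is the pushout of `f` along `a`, and it is isomorphic to `D'`.
  obtain ⟨D, u, l, sq', -⟩ := hS.pushout_mono f a h.admissibleMono
  obtain ⟨q, hq, hD⟩ := hS.exists_conflation_of_isPushout sq' h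
  have hu : AdmissibleMono S u := hS.admissibleMono_of_isPushout sq'.flip ha
  obtain ⟨b', hb'⟩ := hS.lift hk b (by rw [← reassoc_of% hbc, hc.zero, comp_zero])
  have e : f ≫ b' = a ≫ i := by
    rw [← cancel_mono k, Category.assoc, hb', Category.assoc, hi, hab]
  have hiso : IsIso (sq'.desc b' i e) := by
    refine hS.isIso_of_conflation hD hD' _ (by simp) (sq'.hom_ext ?_ ?_)
    · rw [IsPushout.inl_desc_assoc, hq, ← cancel_mono c, Category.assoc, hd, reassoc_of% hb', hbc]
    · rw [IsPushout.inr_desc_assoc, hD'.zero, hD.zero]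
  have : b = u ≫ sq'.desc b' i e ≫ k := by simp [hb']
  rw [this]
  exact hS.comp_mono _ _ hu (hS.comp_mono _ _ (hS.admissibleMono_of_isIso _) hk.admissibleMono)

/-- The five lemma for admissible epimorphisms. -/
theorem admissibleEpi_of_conflation {A B Q A' B' Q' : C} {f : A ⟶ B} {g : B ⟶ Q} {f' : A' ⟶ B'}
    {g' : B' ⟶ Q'} (h : Conflation S f g) (h' : Conflation S f' g') {a : A ⟶ A'} {b : B ⟶ B'}
    {c : Q ⟶ Q'} (hab : f ≫ b = a ≫ f') (hbc : g ≫ c = b ≫ g') (ha : AdmissibleEpi S a)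
    (hc : AdmissibleEpi S c) : AdmissibleEpi S b :=
  (hS.op.admissibleMono_of_conflation h'.op h.op (a := c.op) (b := b.op) (c := a.op)
    (Quiver.Hom.unop_inj hbc.symm) (Quiver.Hom.unop_inj hab.symm) hc.op ha.op).unop

/-- Noether's isomorphism theorem: for admissible subobjects `A ⊆ B ⊆ E`, the sequence
`B / A ⟶ E / A ⟶ E / B` is admissible. -/
theorem conflation_quotients {A B E Q R T : C} {f : A ⟶ B} {p : B ⟶ Q} {g : B ⟶ E} {q : E ⟶ R}
    {t : E ⟶ T} (hp : Conflation S f p) (ht : Conflation S g t) (hq : Conflation S (f ≫ g) q)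
    {m : Q ⟶ R} (hm : p ≫ m = g ≫ q) {r : R ⟶ T} (hr : q ≫ r = t) : Conflation S m r := by
  have := hS.epi hp
  have := hS.epi hq
  have sq : IsPushout g p q m := by
    have key (s : PushoutCocone g p) : ∃ l : R ⟶ s.pt, q ≫ l = s.inl :=
      hS.desc hq s.inl (by
        rw [Category.assoc, s.condition, reassoc_of% hp.zero, zero_comp])
    refine ⟨⟨hm.symm⟩, ⟨PushoutCocone.IsColimit.mk _ (fun s => (key s).choose)
      (fun s => (key s).choose_spec) ?_ ?_⟩⟩
    · intro s
      rw [← cancel_epi p, reassoc_of% hm, (key s).choose_spec, s.condition]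
    · intro s l hl _
      rw [← cancel_epi q, hl, (key s).choose_spec]
  refine hS.conflation_of_isPushout sq ht hr ?_
  rw [← cancel_epi p, reassoc_of% hm, hr, ht.zero, comp_zero]

open scoped ZeroObject in
theorem conflation_biprod (X Y : C) [HasBinaryBiproduct X Y] :
    Conflation S (biprod.inl : X ⟶ X ⊞ Y) (biprod.snd : X ⊞ Y ⟶ Y) := by
  have := hS.hasFiniteBiproducts
  exact hS.conflation_of_isPushout (IsPushout.of_has_biproduct X Y).flip
    (hS.conflation_of_isZero_of_isIso (0 : 0 ⟶ Y) (𝟙 Y) (isZero_zero C)) (by simp) (by simp)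

end IsExactCategory

end Basic

/-! ### Exact structures on functor categories -/

section FunctorCategory

variable {C : Type u} [Category.{v} C] [Preadditive C] {S : ObjectProperty (ShortComplex C)}
  {J : Type*} [Category* J]

/-- The short complexes of functors which belong to `S` objectwise. -/
def componentwise (J : Type*) [Category* J] (S : ObjectProperty (ShortComplex C)) :
    ObjectProperty (ShortComplex (J ⥤ C)) :=
  fun T => ∀ j : J, S (T.map ((evaluation J C).obj j))

theorem conflation_componentwise_iff {F G H : J ⥤ C} {f : F ⟶ G} {g : G ⟶ H} :
    Conflation (componentwise J S) f g ↔ ∀ j, Conflation S (f.app j) (g.app j) :=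
  ⟨fun h j => ⟨by rw [← NatTrans.comp_app, h.zero]; rfl, h.2 j⟩,
    fun h => ⟨by ext j; exact (h j).zero, fun j => (h j).2⟩⟩

omit [Preadditive C] in
theorem hasPushout_of_forall_hasPushout_app {F G H : J ⥤ C} (f : F ⟶ G) (g : F ⟶ H)
    (hfg : ∀ j, HasPushout (f.app j) (g.app j)) (j : J) : HasColimit ((span f g).flip.obj j) :=
  hasColimit_of_iso (F := span (f.app j) (g.app j)) (diagramIsoSpan _)

omit [Preadditive C] in
theorem hasPullback_of_forall_hasPullback_app {F G H : J ⥤ C} (f : F ⟶ H) (g : G ⟶ H)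
    (hfg : ∀ j, HasPullback (f.app j) (g.app j)) (j : J) : HasLimit ((cospan f g).flip.obj j) :=
  hasLimit_of_iso (F := cospan (f.app j) (g.app j))
    (diagramIsoCospan ((cospan f g).flip.obj j)).symm

omit [Preadditive C] in
/-- Pushouts of natural transformations are computed objectwise. -/
theorem exists_isPushout_of_forall_hasPushout_app {F G H : J ⥤ C} (f : F ⟶ G) (g : F ⟶ H)
    (hfg : ∀ j, HasPushout (f.app j) (g.app j)) :
    ∃ (K : J ⥤ C) (g' : G ⟶ K) (f' : H ⟶ K), IsPushout f g g' f' ∧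
      ∀ j, IsPushout (f.app j) (g.app j) (g'.app j) (f'.app j) := by
  have := hasPushout_of_forall_hasPushout_app f g hfg
  have sq := IsPushout.of_hasPushout f g
  exact ⟨_, _, _, sq, fun j => sq.map ((evaluation J C).obj j)⟩

omit [Preadditive C] in
/-- Pullbacks of natural transformations are computed objectwise. -/
theorem exists_isPullback_of_forall_hasPullback_app {F G H : J ⥤ C} (f : F ⟶ H) (g : G ⟶ H)
    (hfg : ∀ j, HasPullback (f.app j) (g.app j)) :
    ∃ (K : J ⥤ C) (g' : K ⟶ F) (f' : K ⟶ G), IsPullback g' f' f g ∧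
      ∀ j, IsPullback (g'.app j) (f'.app j) (f.app j) (g.app j) := by
  have := hasPullback_of_forall_hasPullback_app f g hfg
  have sq := IsPullback.of_hasPullback f g
  exact ⟨_, _, _, sq, fun j => sq.map ((evaluation J C).obj j)⟩

namespace IsExactCategory

variable (hS : IsExactCategory S)

include hS

theorem hasPushout {X Y X' : C} {f : X ⟶ Y} (hf : AdmissibleMono S f) (h : X ⟶ X') :
    HasPushout f h := by
  obtain ⟨_, _, _, sq, -⟩ := hS.pushout_mono f h hf
  exact sq.hasPushout

theorem hasPullback {Y Z Z' : C} {g : Y ⟶ Z} (hg : AdmissibleEpi S g) (h : Z' ⟶ Z) :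
    HasPullback g h := by
  obtain ⟨_, _, _, sq, -⟩ := hS.pullback_epi g h hg
  exact sq.hasPullback

open scoped ZeroObject in
/-- The cokernel is obtained as the pushout along a morphism to a zero object. -/
theorem admissibleMono_componentwise_iff {F G : J ⥤ C} {f : F ⟶ G} :
    AdmissibleMono (componentwise J S) f ↔ ∀ j, AdmissibleMono S (f.app j) := by
  have := hS.hasFiniteBiproducts
  refine ⟨fun ⟨H, g, h⟩ j => (conflation_componentwise_iff.1 h j).admissibleMono, fun h => ?_⟩
  obtain ⟨K, g, i, -, sq⟩ := exists_isPushout_of_forall_hasPushout_app f (0 : F ⟶ 0)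
    fun j => hS.hasPushout (h j) _
  have h0 (j : J) : IsZero ((0 : J ⥤ C).obj j) := (isZero_zero (J ⥤ C)).obj j
  refine ((conflation_componentwise_iff (g := g)).2 fun j => ?_).admissibleMono
  have hw : f.app j ≫ g.app j = 0 := by
    rw [(sq j).w, (h0 j).eq_of_src (i.app j) 0, comp_zero]
  have : Epi (g.app j) := by
    refine Preadditive.epi_of_cancel_zero _ fun t ht => ?_
    exact (sq j).hom_ext (by rw [ht, comp_zero]) ((h0 j).eq_of_src _ _)
  refine hS.conflation_of_isCokernel (h j) hw fun T t ht => ?_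
  exact ⟨(sq j).desc t 0 (by rw [ht, comp_zero]), by simp⟩

open scoped ZeroObject in
/-- The kernel is obtained as the pullback along a morphism from a zero object. -/
theorem admissibleEpi_componentwise_iff {F G : J ⥤ C} {f : F ⟶ G} :
    AdmissibleEpi (componentwise J S) f ↔ ∀ j, AdmissibleEpi S (f.app j) := by
  have := hS.hasFiniteBiproducts
  refine ⟨fun ⟨H, g, h⟩ j => (conflation_componentwise_iff.1 h j).admissibleEpi, fun h => ?_⟩
  obtain ⟨K, g, i, -, sq⟩ := exists_isPullback_of_forall_hasPullback_app f (0 : 0 ⟶ G)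
    fun j => hS.hasPullback (h j) _
  have h0 (j : J) : IsZero ((0 : J ⥤ C).obj j) := (isZero_zero (J ⥤ C)).obj j
  refine ((conflation_componentwise_iff (f := g)).2 fun j => ?_).admissibleEpi
  have hw : g.app j ≫ f.app j = 0 := by
    rw [(sq j).w, (h0 j).eq_of_tgt (i.app j) 0, zero_comp]
  have : Mono (g.app j) := by
    refine Preadditive.mono_of_cancel_zero _ fun t ht => ?_
    exact (sq j).hom_ext (by rw [ht, zero_comp]) ((h0 j).eq_of_tgt _ _)
  refine hS.conflation_of_isKernel (h j) hw fun T t ht => ?_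
  exact ⟨(sq j).lift t 0 (by rw [ht, zero_comp]), by simp⟩

/-- Functors with values in an exact category form an exact category. -/
theorem functorCategory (J : Type*) [Category* J] : IsExactCategory (componentwise J S) where
  hasFiniteBiproducts := by
    have := hS.hasFiniteBiproducts
    exact HasFiniteBiproducts.of_hasFiniteProducts
  iso_closed e h j := hS.iso_closed (((evaluation J C).obj j).mapShortComplex.mapIso e) (h j)
  isKernel {T} h := by
    have hT := (conflation_componentwise_iff (f := T.f) (g := T.g)).1 ⟨T.zero, h⟩
    have hm (j) := hS.mono (hT j)
    have : Mono T.f := NatTrans.mono_of_mono_app _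
    refine nonempty_isLimit_kernelFork _ fun A t ht => ?_
    choose s hs using fun j => hS.lift (hT j) (t.app j) (by rw [← NatTrans.comp_app, ht]; rfl)
    exact ⟨⟨s, fun i j f => by
      rw [← cancel_mono (T.f.app j), Category.assoc, Category.assoc, hs, T.f.naturality,
        reassoc_of% hs, t.naturality]⟩, by ext j; exact hs j⟩
  isCokernel {T} h := by
    have hT := (conflation_componentwise_iff (f := T.f) (g := T.g)).1 ⟨T.zero, h⟩
    have hm (j) := hS.epi (hT j)
    have : Epi T.g := NatTrans.epi_of_epi_app _
    refine nonempty_isColimit_cokernelCofork _ fun A t ht => ?_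
    choose s hs using fun j => hS.desc (hT j) (t.app j) (by rw [← NatTrans.comp_app, ht]; rfl)
    exact ⟨⟨s, fun i j f => by
      rw [← cancel_epi (T.g.app i), ← T.g.naturality_assoc, hs, reassoc_of% hs,
        t.naturality]⟩, by ext j; exact hs j⟩
  id_mono F := hS.admissibleMono_componentwise_iff.2 fun j => hS.id_mono _
  id_epi F := hS.admissibleEpi_componentwise_iff.2 fun j => hS.id_epi _
  comp_mono f g hf hg := hS.admissibleMono_componentwise_iff.2 fun j =>
    hS.comp_mono _ _ (hS.admissibleMono_componentwise_iff.1 hf j)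
      (hS.admissibleMono_componentwise_iff.1 hg j)
  comp_epi f g hf hg := hS.admissibleEpi_componentwise_iff.2 fun j =>
    hS.comp_epi _ _ (hS.admissibleEpi_componentwise_iff.1 hf j)
      (hS.admissibleEpi_componentwise_iff.1 hg j)
  pushout_mono f h hf := by
    rw [hS.admissibleMono_componentwise_iff] at hf
    obtain ⟨K, h', f', sq, sq'⟩ := exists_isPushout_of_forall_hasPushout_app f h
      fun j => hS.hasPushout (hf j) _
    exact ⟨K, h', f', sq, hS.admissibleMono_componentwise_iff.2 fun j =>
      hS.admissibleMono_of_isPushout (sq' j) (hf j)⟩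
  pullback_epi f h hf := by
    rw [hS.admissibleEpi_componentwise_iff] at hf
    obtain ⟨K, h', f', sq, sq'⟩ := exists_isPullback_of_forall_hasPullback_app f h
      fun j => hS.hasPullback (hf j) _
    exact ⟨K, h', f', sq, hS.admissibleEpi_componentwise_iff.2 fun j =>
      hS.admissibleEpi_of_isPullback (sq' j) (hf j)⟩

end IsExactCategory

end FunctorCategory

/-! ### Extension-closed full subcategories -/

section ExtensionClosed

variable {C : Type u} [Category.{v} C] [Preadditive C] {S : ObjectProperty (ShortComplex C)}
  {P : ObjectProperty C}

/-- `P` holds for a zero object, and for the middle term of every member of `S` whose outer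
terms satisfy it. -/
structure IsExtensionClosed (S : ObjectProperty (ShortComplex C)) (P : ObjectProperty C) :
    Prop where
  of_isZero : ∀ {X : C}, IsZero X → P X
  of_conflation : ∀ {X Y Z : C} {f : X ⟶ Y} {g : Y ⟶ Z}, Conflation S f g → P X → P Z → P Y

/-- The short complexes in the full subcategory defined by `P` which belong to `S` in the ambient
category. -/
def restrict (S : ObjectProperty (ShortComplex C)) (P : ObjectProperty C) :
    ObjectProperty (ShortComplex P.FullSubcategory) :=
  fun T => S (T.map P.ι)

theorem conflation_restrict_iff {X Y Z : P.FullSubcategory} {f : X ⟶ Y} {g : Y ⟶ Z} :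
    Conflation (restrict S P) f g ↔ Conflation S f.hom g.hom :=
  ⟨fun h => ⟨by rw [← ObjectProperty.FullSubcategory.comp_hom, h.zero]; rfl, h.2⟩,
    fun h => ⟨by ext; exact h.zero, h.2⟩⟩

namespace IsExactCategory

variable (hS : IsExactCategory S) (hP : IsExtensionClosed S P)

include hS hP

open scoped ZeroObject in
theorem hasFiniteBiproducts_fullSubcategory : HasFiniteBiproducts P.FullSubcategory := by
  have := hS.hasFiniteBiproducts
  have := HasBinaryBiproducts.of_hasBinaryProducts (C := C)
  have : HasZeroObject P.FullSubcategory :=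
    ⟨⟨0, hP.of_isZero (isZero_zero C)⟩,
      IsZero.of_full_of_faithful_of_isZero P.ι _ (isZero_zero C)⟩
  have : HasBinaryBiproducts P.FullSubcategory := ⟨fun X Y =>
    hasBinaryBiproduct_of_total
      { pt := ⟨X.obj ⊞ Y.obj, hP.of_conflation (hS.conflation_biprod X.obj Y.obj)
          X.property Y.property⟩
        fst := ObjectProperty.homMk biprod.fst
        snd := ObjectProperty.homMk biprod.snd
        inl := ObjectProperty.homMk biprod.inl
        inr := ObjectProperty.homMk biprod.inr
        inl_fst := by ext; simp
        inl_snd := by ext; simp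
        inr_fst := by ext; simp
        inr_snd := by ext; simp } (P.ι.map_injective biprod.total)⟩
  have : HasFiniteProducts P.FullSubcategory := hasFiniteProducts_of_has_binary_and_terminal
  exact HasFiniteBiproducts.of_hasFiniteProducts

open scoped ZeroObject in
/-- An extension-closed full subcategory of an exact category is an exact category. -/
theorem fullSubcategory : IsExactCategory (restrict S P) where
  hasFiniteBiproducts := hS.hasFiniteBiproducts_fullSubcategory hP
  iso_closed e h := hS.iso_closed (P.ι.mapShortComplex.mapIso e) h
  isKernel {T} h := by
    have hT := (conflation_restrict_iff (f := T.f) (g := T.g)).1 ⟨T.zero, h⟩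
    have := hS.mono hT
    have : Mono T.f := P.ι.mono_of_mono_map this
    refine nonempty_isLimit_kernelFork _ fun A t ht => ?_
    obtain ⟨s, hs⟩ := hS.lift hT t.hom (by
      rw [← ObjectProperty.FullSubcategory.comp_hom, ht]; rfl)
    exact ⟨ObjectProperty.homMk s, by ext; exact hs⟩
  isCokernel {T} h := by
    have hT := (conflation_restrict_iff (f := T.f) (g := T.g)).1 ⟨T.zero, h⟩
    have := hS.epi hT
    have : Epi T.g := P.ι.epi_of_epi_map this
    refine nonempty_isColimit_cokernelCofork _ fun A t ht => ?_
    obtain ⟨s, hs⟩ := hS.desc hT t.hom (by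
      rw [← ObjectProperty.FullSubcategory.comp_hom, ht]; rfl)
    exact ⟨ObjectProperty.homMk s, by ext; exact hs⟩
  id_mono X := by
    have := hS.hasFiniteBiproducts
    exact ((conflation_restrict_iff (Z := ⟨0, hP.of_isZero (isZero_zero C)⟩)
      (g := ObjectProperty.homMk 0)).2
      (hS.conflation_of_isIso_of_isZero (𝟙 _) _ (isZero_zero C))).admissibleMono
  id_epi X := by
    have := hS.hasFiniteBiproducts
    exact ((conflation_restrict_iff (X := ⟨0, hP.of_isZero (isZero_zero C)⟩)
      (f := ObjectProperty.homMk 0)).2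
      (hS.conflation_of_isZero_of_isIso _ (𝟙 _) (isZero_zero C))).admissibleEpi
  comp_mono {X Y Z} f g hf hg := by
    obtain ⟨A, p, hp⟩ := hf
    obtain ⟨B, q, hq⟩ := hg
    have hp := (conflation_restrict_iff (f := f) (g := p)).1 hp
    have hq := (conflation_restrict_iff (f := g) (g := q)).1 hq
    obtain ⟨D, r, hr⟩ := hS.comp_mono _ _ hp.admissibleMono hq.admissibleMono
    have hr : Conflation S (f.hom ≫ g.hom) r := hr
    obtain ⟨m, hm⟩ := hS.desc hp (g.hom ≫ r) (by rw [← Category.assoc, hr.zero])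
    obtain ⟨n, hn⟩ := hS.desc hr q.hom (by rw [Category.assoc, hq.zero, comp_zero])
    have hD : P D := hP.of_conflation (hS.conflation_quotients hp hq hr hm hn) A.property B.property
    exact ((conflation_restrict_iff (Z := ⟨D, hD⟩) (f := f ≫ g)
      (g := ObjectProperty.homMk r)).2 hr).admissibleMono
  comp_epi {X Y Z} f g hf hg := by
    obtain ⟨A, p, hp⟩ := hf
    obtain ⟨B, q, hq⟩ := hg
    have hp := (conflation_restrict_iff (f := p) (g := f)).1 hp
    have hq := (conflation_restrict_iff (f := q) (g := g)).1 hq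
    obtain ⟨D, r, hr⟩ := hS.comp_epi _ _ hp.admissibleEpi hq.admissibleEpi
    have hr : Conflation S r (f.hom ≫ g.hom) := hr
    obtain ⟨m, hm⟩ := hS.lift hq (r ≫ f.hom) (by rw [Category.assoc, hr.zero])
    obtain ⟨n, hn⟩ := hS.lift hr p.hom (by rw [reassoc_of% hp.zero, zero_comp])
    have hD : P D := hP.of_conflation (hS.op.conflation_quotients hq.op hp.op hr.op
      (Quiver.Hom.unop_inj hm) (Quiver.Hom.unop_inj hn)).unop A.property B.property
    exact ((conflation_restrict_iff (X := ⟨D, hD⟩) (g := f ≫ g)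
      (f := ObjectProperty.homMk r)).2 hr).admissibleEpi
  pushout_mono {X Y X'} f h hf := by
    obtain ⟨A, p, hp⟩ := hf
    have hp := (conflation_restrict_iff (f := f) (g := p)).1 hp
    obtain ⟨Y', h', f', sq, -⟩ := hS.pushout_mono _ h.hom hp.admissibleMono
    obtain ⟨q, -, hq⟩ := hS.exists_conflation_of_isPushout sq hp
    have hY : P Y' := hP.of_conflation hq X'.property A.property
    exact ⟨⟨Y', hY⟩, ObjectProperty.homMk h', ObjectProperty.homMk f',
      IsPushout.of_map P.ι (by ext; exact sq.w) sq,
      ((conflation_restrict_iff (g := ObjectProperty.homMk q)).2 hq).admissibleMono⟩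
  pullback_epi {Y Z Z'} f h hf := by
    obtain ⟨A, p, hp⟩ := hf
    have hp := (conflation_restrict_iff (f := p) (g := f)).1 hp
    obtain ⟨Y', h', f', sq, -⟩ := hS.pullback_epi _ h.hom hp.admissibleEpi
    obtain ⟨q, -, hq⟩ := hS.exists_conflation_of_isPullback sq hp
    have hY : P Y' := hP.of_conflation hq A.property Z'.property
    exact ⟨⟨Y', hY⟩, ObjectProperty.homMk h', ObjectProperty.homMk f',
      IsPullback.of_map P.ι (by ext; exact sq.w) sq,
      ((conflation_restrict_iff (f := ObjectProperty.homMk q)).2 hq).admissibleEpi⟩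

end IsExactCategory

end ExtensionClosed

/-! ### The exact structure on diagrams of admissible monomorphisms -/

section MMor

variable {C : Type u} [Category.{v} C] [Preadditive C] {S : ObjectProperty (ShortComplex C)}
  {k : ℕ}

theorem conflation_mmorAdmissible_iff {X Y Z : MMor S k} {f : X ⟶ Y} {g : Y ⟶ Z} :
    Conflation (mmorAdmissible S k) f g ↔ ∀ j, Conflation S (f.hom.app j) (g.hom.app j) :=
  (conflation_restrict_iff (S := componentwise (Fin (k + 1)) S)).trans conflation_componentwise_iff

theorem AdmissibleEpi.hom_app {X Y : MMor S k} {f : X ⟶ Y}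
    (hf : AdmissibleEpi (mmorAdmissible S k) f) (j : Fin (k + 1)) :
    AdmissibleEpi S (f.hom.app j) := by
  obtain ⟨Z, g, h⟩ := hf
  exact (conflation_mmorAdmissible_iff.1 h j).admissibleEpi

namespace IsExactCategory

variable (hS : IsExactCategory S)

include hS

/-- By the five lemma, an extension of diagrams of admissible monomorphisms is again one. -/
theorem isExtensionClosed_isMMor (k : ℕ) :
    IsExtensionClosed (componentwise (Fin (k + 1)) S) (isMMor S k) where
  of_isZero hX i := by
    have := hS.hasFiniteBiproducts
    exact hS.admissibleMono_of_isZero _ (hX.obj _)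
  of_conflation {X Y Z f g} h hX hZ i :=
    hS.admissibleMono_of_conflation (conflation_componentwise_iff.1 h i.castSucc)
      (conflation_componentwise_iff.1 h i.succ) (f.naturality _).symm (g.naturality _).symm
      (hX i) (hZ i)

theorem mmor (k : ℕ) : IsExactCategory (mmorAdmissible S k) :=
  (hS.functorCategory (Fin (k + 1))).fullSubcategory (hS.isExtensionClosed_isMMor k)

theorem admissibleMono_map (X : MMor S k) {i j : Fin (k + 1)} (f : i ⟶ j) :
    AdmissibleMono S (X.obj.map f) := by
  induction j using Fin.induction generalizing i with
  | zero =>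
    obtain rfl : i = 0 := le_antisymm (leOfHom f) (Fin.zero_le _)
    obtain rfl : f = 𝟙 _ := Subsingleton.elim _ _
    rw [X.obj.map_id]
    exact hS.id_mono _
  | succ j ih =>
    obtain h | rfl := (leOfHom f).lt_or_eq
    · obtain rfl : f = homOfLE (Fin.le_castSucc_iff.2 h) ≫ homOfLE j.castSucc_le_succ :=
        Subsingleton.elim _ _
      rw [X.obj.map_comp]
      exact hS.comp_mono _ _ (ih _) (X.property j)
    · obtain rfl : f = 𝟙 _ := Subsingleton.elim _ _
      rw [X.obj.map_id]
      exact hS.id_mono _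

end IsExactCategory

/-! ### Diagrams freely generated in one degree -/

section Free

variable [HasFiniteBiproducts C]

/-- The left adjoint of the evaluation at `i`: the diagram `0 ⟶ ⋯ ⟶ 0 ⟶ A ⟶ ⋯ ⟶ A` with
identities between the copies of `A`, the first of which is in degree `i`. The term in degree `j`
is encoded as the coproduct of copies of `A` indexed by `i ⟶ j`. -/
noncomputable abbrev freeAt (i : Fin (k + 1)) : C ⥤ ComposableArrows C k :=
  evaluationLeftAdjoint C i

/-- The adjunction between `freeAt i` and the evaluation at `i`. -/
noncomputable abbrev freeAtAdj (i : Fin (k + 1)) :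
    freeAt (C := C) i ⊣ (evaluation (Fin (k + 1)) C).obj i :=
  evaluationAdjunctionRight C i

/-- The canonical morphism from `A` to a term of `freeAt i` in degree at least `i`. -/
noncomputable def freeAtι {i j : Fin (k + 1)} (h : i ≤ j) (A : C) :
    A ⟶ ((freeAt i).obj A).obj j :=
  Sigma.ι (fun _ : i ⟶ j => A) (homOfLE h)

theorem freeAtι_desc {i j : Fin (k + 1)} (h : i ≤ j) {A B : C} (f : (i ⟶ j) → (A ⟶ B)) :
    freeAtι h A ≫ Sigma.desc f = f (homOfLE h) :=
  Sigma.ι_desc _ _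

instance {i j : Fin (k + 1)} (h : i ≤ j) (A : C) : IsIso (freeAtι h A) := by
  refine ⟨Sigma.desc fun _ => 𝟙 A, freeAtι_desc h _, Sigma.hom_ext _ _ fun f => ?_⟩
  exact (Category.assoc _ _ _).symm.trans (((freeAtι_desc h fun _ => 𝟙 A) =≫ freeAtι h A).trans
    ((Category.id_comp _).trans (Category.comp_id _).symm))

theorem freeAtι_map {i j l : Fin (k + 1)} (h : i ≤ j) (f : j ⟶ l) (A : C) :
    freeAtι h A ≫ ((freeAt i).obj A).map f = freeAtι (h.trans (leOfHom f)) A :=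
  freeAtι_desc h _

theorem freeAtι_naturality {i j : Fin (k + 1)} (h : i ≤ j) {A B : C} (f : A ⟶ B) :
    freeAtι h A ≫ ((freeAt i).map f).app j = f ≫ freeAtι h B :=
  freeAtι_desc h _

theorem freeAtι_counit {i j : Fin (k + 1)} (h : i ≤ j) (X : ComposableArrows C k) :
    freeAtι h (X.obj i) ≫ ((freeAtAdj i).counit.app X).app j = X.map (homOfLE h) :=
  (freeAtι_desc h _).trans (Category.id_comp _)

theorem isIso_freeAt_map {i j l : Fin (k + 1)} (h : i ≤ j) (f : j ⟶ l) (A : C) :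
    IsIso (((freeAt i).obj A).map f) := by
  have : IsIso (freeAtι h A ≫ ((freeAt i).obj A).map f) := by
    rw [freeAtι_map]
    infer_instance
  exact IsIso.of_isIso_comp_left (freeAtι h A) _

theorem isZero_freeAt {i j : Fin (k + 1)} (h : ¬ i ≤ j) (A : C) :
    IsZero (((freeAt i).obj A).obj j) := by
  rw [IsZero.iff_id_eq_zero]
  exact Sigma.hom_ext _ _ fun f => absurd (leOfHom f) h

namespace IsExactCategory

variable (hS : IsExactCategory S)

include hS

theorem isMMor_freeAt (i : Fin (k + 1)) (A : C) : isMMor S k ((freeAt i).obj A) := by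
  intro j
  by_cases h : i ≤ j.castSucc
  · have := isIso_freeAt_map h (homOfLE j.castSucc_le_succ) A
    exact hS.admissibleMono_of_isIso _
  · exact hS.admissibleMono_of_isZero _ (isZero_freeAt h A)

/-- The diagram `freeAt i` as an object of the monomorphism category. -/
noncomputable abbrev free (i : Fin (k + 1)) (A : C) : MMor S k :=
  ⟨(freeAt i).obj A, hS.isMMor_freeAt i A⟩

theorem conflation_free (i : Fin (k + 1)) {X Y Z : C} {f : X ⟶ Y} {g : Y ⟶ Z}
    (h : Conflation S f g) :
    Conflation (mmorAdmissible S k) (X := hS.free i X) (Y := hS.free i Y) (Z := hS.free i Z)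
      (ObjectProperty.homMk ((freeAt i).map f)) (ObjectProperty.homMk ((freeAt i).map g)) := by
  rw [conflation_mmorAdmissible_iff]
  intro j
  by_cases hj : i ≤ j
  · exact hS.conflation_of_iso h (asIso (freeAtι hj X)) (asIso (freeAtι hj Y))
      (asIso (freeAtι hj Z)) (freeAtι_naturality hj f) (freeAtι_naturality hj g)
  · have : IsIso (((freeAt i).map f).app j) :=
      (isZero_freeAt hj X).isIso (isZero_freeAt hj Y) _
    exact hS.conflation_of_isIso_of_isZero (((freeAt i).map f).app j) (((freeAt i).map g).app j)
      (isZero_freeAt hj Z)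

/-- Every diagram of admissible monomorphisms is obtained from diagrams generated in one degree by
finitely many extensions: if `X` vanishes in degrees less than `i`, then the diagram generated by
`X i` in degree `i` is an admissible subobject of `X`, and the quotient vanishes in one more
degree. -/
theorem mmor_induction {Φ : MMor S k → Prop} (hzero : ∀ X, IsZero X → Φ X)
    (hfree : ∀ i A, Φ (hS.free i A))
    (hext : ∀ {X Y Z : MMor S k} {f : X ⟶ Y} {g : Y ⟶ Z},
      Conflation (mmorAdmissible S k) f g → Φ X → Φ Z → Φ Y) (X : MMor S k) : Φ X := by
  suffices ∀ n ≤ k + 1, ∀ X : MMor S k,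
      (∀ j : Fin (k + 1), j.val < k + 1 - n → IsZero (X.obj.obj j)) → Φ X from
    this (k + 1) le_rfl X (by simp)
  intro n
  induction n with
  | zero =>
    intro _ X hX
    refine hzero X (IsZero.of_full_of_faithful_of_isZero (isMMor S k).ι _ ?_)
    exact Functor.isZero _ fun j => hX j (by omega)
  | succ n ih =>
    intro hn X hX
    let i : Fin (k + 1) := ⟨k - n, by omega⟩
    have hX' (j : Fin (k + 1)) (hj : ¬ i ≤ j) : IsZero (X.obj.obj j) := by
      refine hX j ?_
      simp only [i, Fin.le_def] at hj
      omega
    let c := (freeAtAdj i).counit.app X.obj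
    have hc (j : Fin (k + 1)) : AdmissibleMono S (c.app j) := by
      by_cases hj : i ≤ j
      · have : c.app j = inv (freeAtι hj _) ≫ X.obj.map (homOfLE hj) := by
          rw [IsIso.eq_inv_comp]
          exact freeAtι_counit hj X.obj
        rw [this]
        exact hS.comp_mono _ _ (hS.admissibleMono_of_isIso _) (hS.admissibleMono_map X _)
      · exact hS.admissibleMono_of_isZero _ (isZero_freeAt hj _)
    obtain ⟨Q, q, h⟩ := hS.admissibleMono_componentwise_iff.2 hc
    have h : ∀ j, Conflation S (c.app j) (q.app j) := conflation_componentwise_iff.1 h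
    have hQ : isMMor S k Q := by
      intro j
      have := hS.epi (h j.castSucc)
      by_cases hj : i ≤ j.castSucc
      · let α := homOfLE j.castSucc_le_succ
        have := isIso_freeAt_map hj α (X.obj.obj i)
        have hq : Conflation S (c.app j.castSucc ≫ X.obj.map α) (q.app j.succ) :=
          hS.conflation_of_iso (h j.succ) (asIso (((freeAt i).obj (X.obj.obj i)).map α)).symm
            (Iso.refl _) (Iso.refl _) (by
              rw [Iso.symm_hom, Iso.inv_comp_eq, Iso.refl_hom, Category.comp_id]
              exact (c.naturality α).symm) (by simp)
        obtain ⟨W, t, ht⟩ := X.property j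
        have ht : Conflation S (X.obj.map α) t := ht
        obtain ⟨r, hr⟩ := hS.desc hq t (by rw [Category.assoc, ht.zero, comp_zero])
        exact (hS.conflation_quotients (h j.castSucc) ht hq (q.naturality α).symm
          hr).admissibleMono
      · exact hS.admissibleMono_of_isZero _ (IsZero.of_epi (q.app _) (hX' _ hj))
    refine hext (X := hS.free i (X.obj.obj i)) (Z := ⟨Q, hQ⟩) (f := ObjectProperty.homMk c)
      (g := ObjectProperty.homMk q) (conflation_mmorAdmissible_iff.2 h) (hfree _ _)
      (ih (by omega) _ fun j hj => ?_)
    have := hS.epi (h j)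
    by_cases hj' : i ≤ j
    · obtain rfl : j = i := le_antisymm (by simp only [i, Fin.le_def]; omega) hj'
      have : IsIso (c.app i) := by
        have : IsIso (freeAtι le_rfl _ ≫ c.app i) := by
          have e : freeAtι le_rfl _ ≫ c.app i = X.obj.map (𝟙 i) := freeAtι_counit le_rfl X.obj
          rw [e]
          infer_instance
        exact IsIso.of_isIso_comp_left (freeAtι le_rfl _) _
      rw [IsZero.iff_id_eq_zero, ← cancel_epi (q.app i), ← cancel_epi (c.app i)]
      simp [(h i).zero]
    · exact IsZero.of_epi (q.app j) (hX' j hj')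

end IsExactCategory

end Free

end MMor

/-! ### Projective and injective objects of an exact category -/

section ProjectiveInjective

variable {C : Type u} [Category.{v} C] [Preadditive C] {S : ObjectProperty (ShortComplex C)}

theorem isProjective_of_isZero {X : C} (hX : IsZero X) : IsProjective S X :=
  fun _ _ _ _ _ => ⟨0, hX.eq_of_src _ _⟩

theorem isInjective_of_isZero {X : C} (hX : IsZero X) : IsInjective S X :=
  fun _ _ _ _ _ => ⟨0, hX.eq_of_tgt _ _⟩

theorem IsProjective.of_retract {X P : C} (hP : IsProjective S P) {i : X ⟶ P} {r : P ⟶ X}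
    (h : i ≫ r = 𝟙 X) : IsProjective S X := fun Y Z p hp f => by
  obtain ⟨g, hg⟩ := hP p hp (r ≫ f)
  exact ⟨i ≫ g, by rw [Category.assoc, hg, reassoc_of% h]⟩

theorem IsInjective.of_retract {X I : C} (hI : IsInjective S I) {i : X ⟶ I} {r : I ⟶ X}
    (h : i ≫ r = 𝟙 X) : IsInjective S X := fun Y Z p hp f => by
  obtain ⟨g, hg⟩ := hI p hp (f ≫ i)
  exact ⟨g ≫ r, by rw [reassoc_of% hg, h, Category.comp_id]⟩

/-- Every morphism to `L` extends along every admissible monomorphism with cokernel `Z`. This is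
the vanishing of `Ext¹(Z, L)`. -/
def ExtVanishes (S : ObjectProperty (ShortComplex C)) (Z L : C) : Prop :=
  ∀ ⦃K Y : C⦄ (f : K ⟶ Y) (g : Y ⟶ Z), Conflation S f g → ∀ φ : K ⟶ L, ∃ ψ : Y ⟶ L, f ≫ ψ = φ

theorem isInjective_of_extVanishes {L : C} (h : ∀ Z, ExtVanishes S Z L) : IsInjective S L :=
  fun _ _ i ⟨Z, g, hi⟩ f => h Z i g hi f

namespace IsExactCategory

variable (hS : IsExactCategory S)

include hS

theorem exists_splitting_of_section {X Y Z : C} {f : X ⟶ Y} {g : Y ⟶ Z} (h : Conflation S f g)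
    {s : Z ⟶ Y} (hs : s ≫ g = 𝟙 Z) : ∃ r : Y ⟶ X, f ≫ r = 𝟙 X ∧ r ≫ f + g ≫ s = 𝟙 Y := by
  have := hS.mono h
  obtain ⟨r, hr⟩ := hS.lift h (𝟙 Y - g ≫ s) (by simp [hs])
  exact ⟨r, by rw [← cancel_mono f, Category.assoc, hr]; simp [reassoc_of% h.zero], by simp [hr]⟩

theorem exists_splitting_of_retraction {X Y Z : C} {f : X ⟶ Y} {g : Y ⟶ Z}
    (h : Conflation S f g) {r : Y ⟶ X} (hr : f ≫ r = 𝟙 X) :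
    ∃ s : Z ⟶ Y, s ≫ g = 𝟙 Z ∧ r ≫ f + g ≫ s = 𝟙 Y := by
  have := hS.epi h
  obtain ⟨s, hs⟩ := hS.desc h (𝟙 Y - r ≫ f) (by simp [reassoc_of% hr])
  exact ⟨s, by rw [← cancel_epi g, reassoc_of% hs]; simp [h.zero], by simp [hs]⟩

theorem isProjective_of_conflation {X Y Z : C} {f : X ⟶ Y} {g : Y ⟶ Z} (h : Conflation S f g)
    (hX : IsProjective S X) (hZ : IsProjective S Z) : IsProjective S Y := fun V W p hp t => by
  obtain ⟨s, hs⟩ := hZ g h.admissibleEpi (𝟙 Z)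
  obtain ⟨r, -, hrs⟩ := hS.exists_splitting_of_section h hs
  obtain ⟨a, ha⟩ := hX p hp (f ≫ t)
  obtain ⟨b, hb⟩ := hZ p hp (s ≫ t)
  exact ⟨r ≫ a + g ≫ b, by simpa [ha, hb] using hrs =≫ t⟩

theorem isInjective_of_conflation {X Y Z : C} {f : X ⟶ Y} {g : Y ⟶ Z} (h : Conflation S f g)
    (hX : IsInjective S X) (hZ : IsInjective S Z) : IsInjective S Y := fun V W i hi t => by
  obtain ⟨r, hr⟩ := hX f h.admissibleMono (𝟙 X)
  obtain ⟨s, -, hrs⟩ := hS.exists_splitting_of_retraction h hr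
  obtain ⟨a, ha⟩ := hX i hi (t ≫ r)
  obtain ⟨b, hb⟩ := hZ i hi (t ≫ g)
  exact ⟨a ≫ f + b ≫ s, by simpa [reassoc_of% ha, reassoc_of% hb] using t ≫= hrs⟩

/-- The horseshoe lemma for projective objects. -/
theorem exists_admissibleEpi_of_conflation {X Y Z P Q : C} {f : X ⟶ Y} {g : Y ⟶ Z}
    (h : Conflation S f g) {p : P ⟶ X} (hp : AdmissibleEpi S p) {q : Q ⟶ Z}
    (hQ : IsProjective S Q) (hq : AdmissibleEpi S q) :
    ∃ (R : C) (i : P ⟶ R) (j : R ⟶ Q) (r : R ⟶ Y), Conflation S i j ∧ AdmissibleEpi S r := by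
  have := hS.hasFiniteBiproducts
  have := HasBinaryBiproducts.of_hasBinaryProducts (C := C)
  obtain ⟨t, ht⟩ := hQ g h.admissibleEpi q
  exact ⟨P ⊞ Q, _, _, biprod.desc (p ≫ f) t, hS.conflation_biprod P Q,
    hS.admissibleEpi_of_conflation (hS.conflation_biprod P Q) h (by simp)
      (by ext <;> simp [h.zero, ht]) hp hq⟩

/-- The horseshoe lemma for injective objects. -/
theorem exists_admissibleMono_of_conflation {X Y Z I J : C} {f : X ⟶ Y} {g : Y ⟶ Z}
    (h : Conflation S f g) {p : X ⟶ I} (hI : IsInjective S I) (hp : AdmissibleMono S p)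
    {q : Z ⟶ J} (hq : AdmissibleMono S q) :
    ∃ (R : C) (i : I ⟶ R) (j : R ⟶ J) (r : Y ⟶ R), Conflation S i j ∧ AdmissibleMono S r := by
  have := hS.hasFiniteBiproducts
  have := HasBinaryBiproducts.of_hasBinaryProducts (C := C)
  obtain ⟨t, ht⟩ := hI f h.admissibleMono p
  exact ⟨I ⊞ J, _, _, biprod.lift t (g ≫ q), hS.conflation_biprod I J,
    hS.admissibleMono_of_conflation h (hS.conflation_biprod I J)
      (by ext <;> simp [reassoc_of% h.zero, ht]) (by simp) hp hq⟩

theorem extVanishes_of_isZero {Z L : C} (hZ : IsZero Z) : ExtVanishes S Z L :=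
  fun K Y f g h φ => by
    have := hS.mono h
    obtain ⟨s, hs⟩ := hS.lift h (𝟙 Y) (hZ.eq_of_tgt _ _)
    exact ⟨s ≫ φ, by rw [← Category.assoc, show f ≫ s = 𝟙 K by
      rw [← cancel_mono f, Category.assoc, hs]; simp, Category.id_comp]⟩

/-- Half-exactness of `Ext¹(-, L)`. -/
theorem extVanishes_of_conflation {X Y Z L : C} {a : X ⟶ Y} {b : Y ⟶ Z} (h : Conflation S a b)
    (hX : ExtVanishes S X L) (hZ : ExtVanishes S Z L) : ExtVanishes S Y L := fun K E f g hfg φ => by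
  have := hS.mono h
  obtain ⟨E', h', g', sq, -⟩ := hS.pullback_epi g a hfg.admissibleEpi
  obtain ⟨i, hi, hi'⟩ := hS.exists_conflation_of_isPullback sq hfg
  obtain ⟨ψ', hψ'⟩ := hX i g' hi' φ
  have : Mono h' := by
    refine Preadditive.mono_of_cancel_zero _ fun t ht => sq.hom_ext (by simp [ht]) ?_
    rw [← cancel_mono a, Category.assoc, ← sq.w, reassoc_of% ht]
    simp
  have hE : Conflation S h' (g ≫ b) := by
    refine hS.conflation_of_isKernel (hS.comp_epi _ _ hfg.admissibleEpi h.admissibleEpi)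
      (by rw [sq.w_assoc, h.zero, comp_zero]) fun T t ht => ?_
    obtain ⟨s, hs⟩ := hS.lift h (t ≫ g) (by rw [Category.assoc, ht])
    exact ⟨sq.lift t s hs.symm, by simp⟩
  obtain ⟨ψ, hψ⟩ := hZ h' (g ≫ b) hE ψ'
  exact ⟨ψ, by rw [← hi, Category.assoc, hψ, hψ']⟩

/-- When `Q` is closed under finite direct sums, the morphisms factoring through `Q` already form
a subgroup. -/
theorem mem_factorIdeal_iff {Q : ObjectProperty C} (hQ : IsExtensionClosed S Q) {X Y : C}
    {f : X ⟶ Y} : f ∈ factorIdeal Q X Y ↔ FactorsThrough Q f := by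
  have := hS.hasFiniteBiproducts
  have := HasBinaryBiproducts.of_hasBinaryProducts (C := C)
  refine ⟨fun h => ?_, fun h => AddSubgroup.subset_closure h⟩
  induction h using AddSubgroup.closure_induction with
  | mem f hf => exact hf
  | zero => exact ⟨_, 0, 0, hQ.of_isZero (isZero_zero C), by simp⟩
  | add f g _ _ hf hg =>
    obtain ⟨P, a, b, hP, rfl⟩ := hf
    obtain ⟨P', a', b', hP', rfl⟩ := hg
    exact ⟨P ⊞ P', biprod.lift a a', biprod.desc b b',
      hQ.of_conflation (hS.conflation_biprod P P') hP hP', by simp⟩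
  | neg f _ hf =>
    obtain ⟨P, a, b, hP, rfl⟩ := hf
    exact ⟨P, a, -b, hP, by simp⟩

theorem isExtensionClosed_isProjective : IsExtensionClosed S (IsProjective S) where
  of_isZero := isProjective_of_isZero
  of_conflation := hS.isProjective_of_conflation

end IsExactCategory

end ProjectiveInjective

/-! ### Projective and injective diagrams of admissible monomorphisms -/

section Frobenius

variable {C : Type u} [Category.{v} C] [Preadditive C] {S : ObjectProperty (ShortComplex C)}
  {k : ℕ}

theorem isZero_obj_obj {X : MMor S k} (hX : IsZero X) (j : Fin (k + 1)) :
    IsZero (X.obj.obj j) := by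
  rw [IsZero.iff_id_eq_zero] at hX ⊢
  exact congr_arg (fun f : X ⟶ X => f.hom.app j) hX

namespace IsExactCategory

variable (hS : IsExactCategory S)

include hS

/-- `free i` preserves projective objects because its right adjoint, the evaluation at `i`,
preserves admissible epimorphisms. -/
theorem isProjective_free [HasFiniteBiproducts C] (i : Fin (k + 1)) {P : C}
    (hP : IsProjective S P) : IsProjective (mmorAdmissible S k) (hS.free i P) := by
  intro Y Z p hp f
  obtain ⟨g, hg⟩ := hP (p.hom.app i) (hp.hom_app i) ((freeAtAdj i).homEquiv _ _ f.hom)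
  refine ⟨ObjectProperty.homMk (((freeAtAdj i).homEquiv _ _).symm g), ?_⟩
  ext : 1
  apply ((freeAtAdj i).homEquiv _ _).injective
  exact ((freeAtAdj i).homEquiv_naturality_right _ _).trans (by simpa using hg)

/-- The terms of `free i P` are isomorphic to `P` or zero, so they inherit every property of `P`
which passes to retracts and holds for zero objects. -/
theorem free_obj_induction [HasFiniteBiproducts C] {Φ : C → Prop} (hzero : ∀ X, IsZero X → Φ X)
    (hretract : ∀ {X Y : C} {i : X ⟶ Y} {r : Y ⟶ X}, Φ Y → i ≫ r = 𝟙 X → Φ X)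
    (i j : Fin (k + 1)) {P : C} (hP : Φ P) : Φ ((hS.free i P).obj.obj j) := by
  by_cases h : i ≤ j
  · exact hretract hP (IsIso.inv_hom_id (freeAtι h P))
  · exact hzero _ (isZero_freeAt h P)

/-- By adjunction, `Ext¹(free i A, L)` is `Ext¹(A, L i)`. -/
theorem extVanishes_free [HasFiniteBiproducts C] (i : Fin (k + 1)) (A : C) {L : MMor S k}
    (hL : IsInjective S (L.obj.obj i)) :
    ExtVanishes (mmorAdmissible S k) (hS.free i A) L := by
  intro K Y f g hfg φ
  obtain ⟨Y', h', f', sq, -⟩ := (hS.mmor k).pushout_mono f φ hfg.admissibleMono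
  obtain ⟨q, -, hq⟩ := (hS.mmor k).exists_conflation_of_isPushout sq hfg
  have hqi := conflation_mmorAdmissible_iff.1 hq i
  -- The pushout sequence splits in degree `i`, hence it splits by adjunction.
  obtain ⟨ρ, hρ⟩ := hL _ hqi.admissibleMono (𝟙 _)
  obtain ⟨σ, hσ, -⟩ := hS.exists_splitting_of_retraction hqi hρ
  let s : hS.free i A ⟶ Y' :=
    ObjectProperty.homMk (((freeAtAdj i).homEquiv _ _).symm ((freeAtAdj i).unit.app A ≫ σ))
  have hs : s ≫ q = 𝟙 _ := by
    ext : 1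
    apply ((freeAtAdj i).homEquiv _ _).injective
    refine ((freeAtAdj i).homEquiv_naturality_right _ _).trans ?_
    simp only [s, ObjectProperty.homMk_hom, Equiv.apply_symm_apply, evaluation_obj_map]
    rw [Category.assoc]
    refine ((freeAtAdj i).unit.app A ≫= hσ).trans ?_
    rw [Adjunction.homEquiv_unit]
    rfl
  obtain ⟨r, hr, -⟩ := (hS.mmor k).exists_splitting_of_section hq hs
  exact ⟨h' ≫ r, by rw [sq.w_assoc, hr, Category.comp_id]⟩

/-- A diagram with injective terms is injective, because `Ext¹(-, L)` vanishes on the diagrams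
generated in one degree and hence, by extensions, on all diagrams. -/
theorem isInjective_mmor {L : MMor S k} (hL : ∀ j, IsInjective S (L.obj.obj j)) :
    IsInjective (mmorAdmissible S k) L := by
  have := hS.hasFiniteBiproducts
  refine isInjective_of_extVanishes fun Z => ?_
  induction Z using hS.mmor_induction with
  | hzero Z hZ => exact (hS.mmor k).extVanishes_of_isZero hZ
  | hfree i A => exact hS.extVanishes_free i A (hL i)
  | hext h hX hZ => exact (hS.mmor k).extVanishes_of_conflation h hX hZ

end IsExactCategory

namespace IsFrobeniusExact

variable (hS : IsFrobeniusExact S)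

include hS

/-- Enough projectives, by the horseshoe lemma; the projective diagrams constructed here have
projective terms. -/
theorem exists_projective_mmor (X : MMor S k) : ∃ (P : MMor S k) (p : P ⟶ X),
    (IsProjective (mmorAdmissible S k) P ∧ ∀ j, IsProjective S (P.obj.obj j)) ∧
      AdmissibleEpi (mmorAdmissible S k) p := by
  have hE := hS.toIsExactCategory
  have := hE.hasFiniteBiproducts
  induction X using hE.mmor_induction with
  | hzero X hX =>
    exact ⟨X, 𝟙 X, ⟨isProjective_of_isZero hX,
      fun j => isProjective_of_isZero (isZero_obj_obj hX j)⟩, (hE.mmor k).id_epi X⟩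
  | hfree i A =>
    obtain ⟨P, p, hP, K, f, hp⟩ := hS.enough_projectives A
    exact ⟨hE.free i P, _, ⟨hE.isProjective_free i hP, fun j =>
      hE.free_obj_induction (fun _ => isProjective_of_isZero)
        (fun h e => h.of_retract e) i j hP⟩,
      (hE.conflation_free i hp).admissibleEpi⟩
  | hext h hX hZ =>
    obtain ⟨P, p, ⟨hP, hP'⟩, hp⟩ := hX
    obtain ⟨Q, q, ⟨hQ, hQ'⟩, hq⟩ := hZ
    obtain ⟨R, i, j, r, hij, hr⟩ := (hE.mmor k).exists_admissibleEpi_of_conflation h hp hQ hq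
    exact ⟨R, r, ⟨(hE.mmor k).isProjective_of_conflation hij hP hQ, fun l =>
      hE.isProjective_of_conflation (conflation_mmorAdmissible_iff.1 hij l) (hP' l) (hQ' l)⟩, hr⟩

/-- Enough injectives, by the horseshoe lemma; the injective diagrams constructed here have
injective terms. -/
theorem exists_injective_mmor (X : MMor S k) : ∃ (I : MMor S k) (i : X ⟶ I),
    (∀ j, IsInjective S (I.obj.obj j)) ∧ AdmissibleMono (mmorAdmissible S k) i := by
  have hE := hS.toIsExactCategory
  have := hE.hasFiniteBiproducts
  induction X using hE.mmor_induction with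
  | hzero X hX =>
    exact ⟨X, 𝟙 X, fun j => isInjective_of_isZero (isZero_obj_obj hX j), (hE.mmor k).id_mono X⟩
  | hfree i A =>
    obtain ⟨I, p, hI, K, f, hp⟩ := hS.enough_injectives A
    exact ⟨hE.free i I, _, fun j =>
      hE.free_obj_induction (fun _ => isInjective_of_isZero)
        (fun h e => h.of_retract e) i j hI,
      (hE.conflation_free i hp).admissibleMono⟩
  | hext h hX hZ =>
    obtain ⟨P, p, hP, hp⟩ := hX
    obtain ⟨Q, q, hQ, hq⟩ := hZ
    obtain ⟨R, i, j, r, hij, hr⟩ := (hE.mmor k).exists_admissibleMono_of_conflation h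
      (hE.isInjective_mmor hP) hp hq
    exact ⟨R, r, fun l =>
      hE.isInjective_of_conflation (conflation_mmorAdmissible_iff.1 hij l) (hP l) (hQ l), hr⟩

theorem isInjective_mmor_iff {X : MMor S k} :
    IsInjective (mmorAdmissible S k) X ↔ ∀ j, IsInjective S (X.obj.obj j) := by
  refine ⟨fun h j => ?_, hS.toIsExactCategory.isInjective_mmor⟩
  obtain ⟨I, i, hI, hi⟩ := hS.exists_injective_mmor X
  obtain ⟨r, hr⟩ := h i hi (𝟙 X)
  exact (hI j).of_retract (i := i.hom.app j) (r := r.hom.app j)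
    (congr_arg (fun f : X ⟶ X => f.hom.app j) hr)

theorem isProjective_mmor_iff {X : MMor S k} :
    IsProjective (mmorAdmissible S k) X ↔ ∀ j, IsProjective S (X.obj.obj j) := by
  have hE := hS.toIsExactCategory
  obtain ⟨P, p, ⟨hP, hP'⟩, hp⟩ := hS.exists_projective_mmor X
  refine ⟨fun h j => ?_, fun h => ?_⟩
  · obtain ⟨s, hs⟩ := h p hp (𝟙 X)
    exact (hP' j).of_retract (i := s.hom.app j) (r := p.hom.app j)
      (congr_arg (fun f : X ⟶ X => f.hom.app j) hs)
  · obtain ⟨K, i, hi⟩ := hp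
    have hi : Conflation (mmorAdmissible S k) i p := hi
    -- The kernel of `p` is a degreewise retract of `P`, hence injective, so `p` splits.
    have hK : IsInjective (mmorAdmissible S k) K := hE.isInjective_mmor fun j => by
      have hij := conflation_mmorAdmissible_iff.1 hi j
      obtain ⟨s, hs⟩ := h j _ hij.admissibleEpi (𝟙 _)
      obtain ⟨r, hr, -⟩ := hE.exists_splitting_of_section hij hs
      exact (hS.projective_iff_injective _).1 ((hP' j).of_retract hr)
    obtain ⟨r, hr⟩ := hK i hi.admissibleMono (𝟙 K)
    obtain ⟨s, hs, -⟩ := (hE.mmor k).exists_splitting_of_retraction hi hr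
    exact hP.of_retract hs

theorem mmor (k : ℕ) : IsFrobeniusExact (mmorAdmissible S k) where
  toIsExactCategory := hS.toIsExactCategory.mmor k
  enough_projectives X := by
    obtain ⟨P, p, hP, hp⟩ := hS.exists_projective_mmor X
    exact ⟨P, p, hP.1, hp⟩
  enough_injectives X := by
    obtain ⟨I, i, hI, hi⟩ := hS.exists_injective_mmor X
    exact ⟨I, i, hS.toIsExactCategory.isInjective_mmor hI, hi⟩
  projective_iff_injective X := by
    rw [hS.isProjective_mmor_iff, hS.isInjective_mmor_iff]
    exact forall_congr' fun j => hS.projective_iff_injective _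

/-- The splitting of the morphisms is automatic: an admissible monomorphism whose source is
injective splits. -/
theorem isSplitProjInjDiagram_iff {X : MMor S k} :
    IsSplitProjInjDiagram S k X ↔ ∀ j, IsInjective S (X.obj.obj j) := by
  refine ⟨fun h j => (h.1 j).2,
    fun h => ⟨fun j => ⟨(hS.projective_iff_injective _).2 (h j), h j⟩, fun j => ?_⟩⟩
  obtain ⟨r, hr⟩ := h j.castSucc _ (X.property j) (𝟙 _)
  exact ⟨⟨⟨r, hr⟩⟩⟩

theorem isInjective_mmor_eq (k : ℕ) :
    IsInjective (mmorAdmissible S k) = IsSplitProjInjDiagram S k :=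
  funext fun _ => propext (hS.isInjective_mmor_iff.trans hS.isSplitProjInjDiagram_iff.symm)

theorem isProjective_mmor_eq (k : ℕ) :
    IsProjective (mmorAdmissible S k) = IsSplitProjInjDiagram S k :=
  (funext fun X => propext ((hS.mmor k).projective_iff_injective X)).trans
    (hS.isInjective_mmor_eq k)

end IsFrobeniusExact

end Frobenius

end NStab

theorem mainTheorem3 {C : Type u} [Category.{v} C] [Preadditive C]
    (S : ObjectProperty (ShortComplex C)) (hS : NStab.IsFrobeniusExact S) :
    (∀ k : ℕ,
      NStab.IsFrobeniusExact (NStab.mmorAdmissible S k) ∧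
      ∀ X : NStab.MMor S k,
        (NStab.IsProjective (NStab.mmorAdmissible S k) X ↔ NStab.IsSplitProjInjDiagram S k X) ∧
        (NStab.IsInjective (NStab.mmorAdmissible S k) X ↔ NStab.IsSplitProjInjDiagram S k X)) ∧
    (∀ N : ℕ, 2 ≤ N →
      (∀ X Y : NStab.MMor S (N - 2),
        NStab.factorIdeal (NStab.IsProjective (NStab.mmorAdmissible S (N - 2))) X Y =
          NStab.factorIdeal (NStab.IsInjective (NStab.mmorAdmissible S (N - 2))) X Y) ∧
      Function.Bijective (NStab.toNStable S N).obj ∧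
      (NStab.toNStable S N).Full ∧
      (NStab.toNStable S N).Additive ∧
      ∀ ⦃X Y : NStab.MMor S (N - 2)⦄ (f g : X ⟶ Y),
        (NStab.toNStable S N).map f = (NStab.toNStable S N).map g ↔
          NStab.FactorsThrough (NStab.IsSplitProjInjDiagram S (N - 2)) (f - g)) := by
  refine ⟨fun k => ⟨hS.mmor k, fun X => ?_⟩, fun N _ => ⟨fun X Y => ?_, ?_, ?_, ?_, ?_⟩⟩
  · rw [hS.isProjective_mmor_eq, hS.isInjective_mmor_eq]
    exact ⟨Iff.rfl, Iff.rfl⟩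
  · rw [hS.isProjective_mmor_eq, hS.isInjective_mmor_eq]
  · exact (Quotient.equiv _).symm.bijective
  · infer_instance
  · exact Quotient.functor_additive _ _
  · intro X Y f g
    rw [← hS.isProjective_mmor_eq,
      ← (hS.mmor (N - 2)).mem_factorIdeal_iff (hS.mmor (N - 2)).isExtensionClosed_isProjective]
    exact Quotient.functor_map_eq_iff _ f g
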